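/- Let $v\in L^\infty(\mathbb R)$ be real-valued with $v\ge 0$ almost everywhere. For $L>0$ let $I=(-L/2,L/2)$ and let $h_L=-\frac{d^2}{dx^2}+v$ be the Schrödinger operator on $L^2(I)$ with Neumann boundary conditions, that is, with domain $\{f\in H^2(I): f'(-L/2)=f'(L/2)=0\}$. Let $\varphi_L^0\in L^2(I)$ be a normalized ground-state eigenfunction of $h_L$, i.e. an eigenfunction for the smallest eigenvalue of $h_L$ with $\|\varphi_L^0\|_{L^2(I)}=1$, represented by a continuously differentiable function. Then, for all $L>0$, $$\inf_{x\in I}|\varphi_L^0(x)|\ \ge\ \frac{e^{-4L\|v\|_{L^1(I)}}}{\sqrt L}$$ and $$\inf_{x\in I}|\varphi_L^0(x)|\ \ge\ e^{-4L\|v\|_{L^1(I)}}\cdot\sup_{x\in I}|\varphi_L^0(x)| .$$ -/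

import Mathlib

open MeasureTheory

noncomputable section

namespace NeumannSchrodinger

/-- The open interval `I = (-L/2, L/2)`. -/
def interval (L : ℝ) : Set ℝ := Set.Ioo (-(L / 2)) (L / 2)

/-- `f` is an element of the domain of the Neumann operator on `I = (-L/2, L/2)`, with first
derivative `f₁` and weak second derivative `f₂`. That is, `f` is the `C¹` representative of an
element of the Sobolev space `H²(I)`: it is continuously differentiable up to the endpoints
(one-sided derivatives there), its derivative `f₁` is absolutely continuous, being an indefinite
integral of `f₂ ∈ L²(I)`, and `f₁` vanishes at both endpoints. -/
structure InDomain (L : ℝ) (f f₁ f₂ : ℝ → ℂ) : Prop where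
  memLp : MemLp f₂ 2 (volume.restrict (interval L))
  hasDeriv : ∀ x ∈ Set.Icc (-(L / 2)) (L / 2),
    HasDerivWithinAt f (f₁ x) (Set.Icc (-(L / 2)) (L / 2)) x
  deriv_eq : ∀ x ∈ Set.Icc (-(L / 2)) (L / 2),
    f₁ x = f₁ (-(L / 2)) + ∫ t in (-(L / 2))..x, f₂ t
  neumann_left : f₁ (-(L / 2)) = 0
  neumann_right : f₁ (L / 2) = 0

/-- `f` is an eigenfunction, with eigenvalue `μ`, of the Schrödinger operator
`h_L = -d²/dx² + v` on `I` with Neumann boundary conditions: `f` is a nonzero element of the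
domain and `-f'' + v f = μ f` in `L²(I)`. -/
def IsEigenfunction (v : ℝ → ℝ) (L μ : ℝ) (f : ℝ → ℂ) : Prop :=
  ∃ f₁ f₂ : ℝ → ℂ, InDomain L f f₁ f₂ ∧ (∃ x ∈ interval L, f x ≠ 0) ∧
    ∀ᵐ x ∂(volume.restrict (interval L)), -f₂ x + (v x : ℂ) * f x = (μ : ℂ) * f x

/-- `μ` is an eigenvalue of `h_L`. All eigenvalues are real because `h_L` is self-adjoint. -/
def IsEigenvalue (v : ℝ → ℝ) (L μ : ℝ) : Prop :=
  ∃ f : ℝ → ℂ, IsEigenfunction v L μ f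

/-- `φ` is a normalized ground-state eigenfunction of `h_L`: an eigenfunction for the smallest
eigenvalue `μ` of `h_L`, of norm one in `L²(I)`. No choice of phase is imposed. -/
def IsNormalizedGroundState (v : ℝ → ℝ) (L : ℝ) (φ : ℝ → ℂ) : Prop :=
  ∃ μ : ℝ, IsLeast {ν : ℝ | IsEigenvalue v L ν} μ ∧ IsEigenfunction v L μ φ ∧
    ∫ x in interval L, ‖φ x‖ ^ 2 = 1

end NeumannSchrodinger

end

namespace NeumannSchrodinger

open Set

/-! Put `a = -L/2`, `b = L/2`, `w t = ∫ s in a..t, v s`. With the quasi-derivative `z = y' - w y`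
the equation `-y'' + v y = ν y` becomes `y' = z + w y`, `z' = -(ν + w²) y - w z`, whose coefficients
are continuous although `v` is only bounded. The Neumann conditions read `z a = 0` and `z b + w b *
y b = 0`.

The solution for the smallest eigenvalue `μ` has no zero (`exists_pos_system_of_isLeast`). Otherwise
its Prüfer angle, starting at `0`, would end at or below `-π/2`; for very negative `ν` it ends at or
above `0`, so by continuity some `ν < μ` gives the Neumann angle `-arctan (w b)` and is an
eigenvalue (`exists_isEigenvalue_lt`). A Wronskian argument makes every ground state a constant
multiple of this positive `y` (`exists_eq_const_mul_of_system`).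

Since `v ≥ 0`, also `μ ≥ 0`, so `q = z / y` decreases from `0` to `-w b` by its Riccati equation,
while `w` increases from `0` to `w b`. Hence `|(log y)'| = |q + w| ≤ w b`, the `L¹` norm of `v`, and
integration gives the Harnack inequality `le_exp_mul_of_system`. Normalization forces `sup |φ| ≥
1/√L`, so the second bound implies the first. -/

/-! ### One-way crossing of levels -/

/-- A function whose derivative is negative wherever it takes the value `c` stays below `c` once
it is below `c`. -/
theorem le_of_le_of_deriv_neg_on_level {a b c : ℝ} {θ θ' : ℝ → ℝ}
    (hθ : ∀ t ∈ Icc a b, HasDerivWithinAt θ (θ' t) (Icc a b) t)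
    (hc : ∀ t ∈ Icc a b, θ t = c → θ' t < 0) {x y : ℝ} (hx : x ∈ Icc a b) (hy : y ∈ Icc a b)
    (hxy : x ≤ y) (h : θ x ≤ c) : θ y ≤ c := by
  have hsub : Icc x y ⊆ Icc a b := Icc_subset_Icc hx.1 hy.2
  refine image_le_of_deriv_right_lt_deriv_boundary (f := θ) (f' := θ') (a := x) (b := y)
    (B := fun _ => c) (B' := fun _ => 0) ?_ ?_ h (fun t => hasDerivAt_const t c) ?_
    (right_mem_Icc.2 hxy)
  · exact fun t ht => ((hθ t (hsub ht)).continuousWithinAt).mono hsub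
  · intro t ht
    have hmem := hsub (Ico_subset_Icc_self ht)
    refine (hθ t hmem).mono_of_mem_nhdsWithin ?_
    exact Filter.mem_of_superset (Icc_mem_nhdsGE (ht.2.trans_le hy.2))
      (Icc_subset_Icc hmem.1 le_rfl)
  · intro t ht hte
    exact hc t (hsub (Ico_subset_Icc_self ht)) hte

/-- A function whose derivative is negative wherever it takes the value `c` was above `c` before
every time at which it is above `c`. -/
theorem ge_of_ge_of_deriv_neg_on_level {a b c : ℝ} {θ θ' : ℝ → ℝ}
    (hθ : ∀ t ∈ Icc a b, HasDerivWithinAt θ (θ' t) (Icc a b) t)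
    (hc : ∀ t ∈ Icc a b, θ t = c → θ' t < 0) {x y : ℝ} (hx : x ∈ Icc a b) (hy : y ∈ Icc a b)
    (hxy : x ≤ y) (h : c ≤ θ y) : c ≤ θ x := by
  -- Reversing both time and sign preserves the derivative condition and exchanges past and future.
  have key := le_of_le_of_deriv_neg_on_level (a := -b) (b := -a) (c := -c)
    (θ := fun s => -θ (-s)) (θ' := fun s => θ' (-s)) (x := -y) (y := -x) ?_ ?_
    ⟨by linarith [hy.2], by linarith [hy.1]⟩ ⟨by linarith [hx.2], by linarith [hx.1]⟩
    (by linarith) (by simpa using h)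
  · simpa using key
  · intro t ht
    have hmaps : MapsTo (fun s : ℝ => -s) (Icc (-b) (-a)) (Icc a b) :=
      fun s hs => ⟨by linarith [hs.2], by linarith [hs.1]⟩
    have := ((hθ (-t) (hmaps ht)).scomp t (hasDerivWithinAt_id t _).neg hmaps).neg
    exact HasDerivWithinAt.congr_deriv (f := fun s => -θ (-s)) this (by simp)
  · intro t ht hte
    exact hc (-t) ⟨by linarith [ht.2], by linarith [ht.1]⟩ (by simpa using hte)

/-! ### Prüfer angle and radius -/

/-- The vector field driving the Prüfer angle of the system
`y' = z + w y`, `z' = -(ν + w²) y - w z`. -/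
noncomputable def pruferField (w : ℝ → ℝ) (ν t θ : ℝ) : ℝ :=
  -(ν + w t ^ 2) * Real.cos θ ^ 2 - 2 * w t * Real.sin θ * Real.cos θ - Real.sin θ ^ 2

/-- `θ` is the Prüfer angle on `[a, b]` starting at `0`. -/
structure IsPruferAngle (a b : ℝ) (w : ℝ → ℝ) (ν : ℝ) (θ : ℝ → ℝ) : Prop where
  initial : θ a = 0
  hasDeriv : ∀ t ∈ Icc a b, HasDerivWithinAt θ (pruferField w ν t (θ t)) (Icc a b) t

theorem IsPruferAngle.continuousOn {a b : ℝ} {w : ℝ → ℝ} {ν : ℝ} {θ : ℝ → ℝ}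
    (h : IsPruferAngle a b w ν θ) : ContinuousOn θ (Icc a b) :=
  fun t ht => (h.hasDeriv t ht).continuousWithinAt

/-- The derivative in `θ` is `(ν + w² - 1) sin 2θ - 2 w cos 2θ`. The constant is generous so that it
also bounds the field itself in `abs_pruferField_le`. -/
theorem lipschitzWith_pruferField {w : ℝ → ℝ} {ν t W : ℝ} (hW : |w t| ≤ W) :
    LipschitzWith (2 * (|ν| + W ^ 2) + 4 * W + 2).toNNReal (pruferField w ν t) := by
  have hd : ∀ θ, HasDerivAt (pruferField w ν t)
      (-(ν + w t ^ 2) * (2 * Real.cos θ * -Real.sin θ)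
        - (2 * w t * Real.cos θ * Real.cos θ + 2 * w t * Real.sin θ * -Real.sin θ)
        - 2 * Real.sin θ * Real.cos θ) θ := by
    intro θ
    have h1 := ((Real.hasDerivAt_cos θ).pow 2).const_mul (-(ν + w t ^ 2))
    have h2 := ((Real.hasDerivAt_sin θ).const_mul (2 * w t)).mul (Real.hasDerivAt_cos θ)
    have h3 := (Real.hasDerivAt_sin θ).pow 2
    have := (h1.sub h2).sub h3
    convert! this using 1
    push_cast
    ring
  refine lipschitzWith_of_nnnorm_deriv_le (fun θ => (hd θ).differentiableAt) fun θ => ?_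
  rw [(hd θ).deriv, ← NNReal.coe_le_coe, coe_nnnorm, Real.norm_eq_abs]
  refine le_trans ?_ (Real.le_coe_toNNReal _)
  have hcs := Real.sin_sq_add_cos_sq θ
  have e1 : |2 * (Real.sin θ * Real.cos θ)| ≤ 1 := by
    rw [abs_le]
    constructor <;> nlinarith [sq_nonneg (Real.sin θ + Real.cos θ),
      sq_nonneg (Real.sin θ - Real.cos θ)]
  have e2 : |Real.cos θ ^ 2 - Real.sin θ ^ 2| ≤ 1 := by
    rw [abs_le]
    constructor <;> nlinarith [sq_nonneg (Real.sin θ), sq_nonneg (Real.cos θ)]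
  have hW0 : 0 ≤ W := (abs_nonneg _).trans hW
  have hw2 : w t ^ 2 ≤ W ^ 2 := sq_le_sq.2 (by rwa [abs_of_nonneg hW0])
  have hA : |ν + w t ^ 2 - 1| ≤ |ν| + W ^ 2 + 1 := by
    rw [abs_le]
    constructor <;> nlinarith [neg_abs_le ν, le_abs_self ν, sq_nonneg (w t)]
  have hB : |2 * w t| ≤ 2 * W := by rw [abs_mul, abs_two]; linarith
  calc _ = |(ν + w t ^ 2 - 1) * (2 * (Real.sin θ * Real.cos θ))
        - 2 * w t * (Real.cos θ ^ 2 - Real.sin θ ^ 2)| := by congr 1; ring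
    _ ≤ |ν + w t ^ 2 - 1| * |2 * (Real.sin θ * Real.cos θ)|
        + |2 * w t| * |Real.cos θ ^ 2 - Real.sin θ ^ 2| := by
        rw [← abs_mul, ← abs_mul]; exact abs_sub _ _
    _ ≤ (|ν| + W ^ 2 + 1) * 1 + 2 * W * 1 := by gcongr
    _ ≤ _ := by nlinarith [abs_nonneg ν, sq_nonneg W]

theorem abs_pruferField_le {w : ℝ → ℝ} {ν t W : ℝ} (hW : |w t| ≤ W) (θ : ℝ) :
    |pruferField w ν t θ| ≤ 2 * (|ν| + W ^ 2) + 4 * W + 2 := by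
  have hcs := Real.sin_sq_add_cos_sq θ
  have e1 : |2 * (Real.sin θ * Real.cos θ)| ≤ 1 := by
    rw [abs_le]
    constructor <;> nlinarith [sq_nonneg (Real.sin θ + Real.cos θ),
      sq_nonneg (Real.sin θ - Real.cos θ)]
  have hW0 : 0 ≤ W := (abs_nonneg _).trans hW
  have hw2 : w t ^ 2 ≤ W ^ 2 := sq_le_sq.2 (by rwa [abs_of_nonneg hW0])
  have hA : |ν + w t ^ 2| ≤ |ν| + W ^ 2 := by
    rw [abs_le]
    constructor <;> nlinarith [neg_abs_le ν, le_abs_self ν, sq_nonneg (w t)]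
  have hc1 : |Real.cos θ ^ 2| ≤ 1 := by
    rw [abs_of_nonneg (sq_nonneg _)]; exact Real.cos_sq_le_one θ
  have hs1 : |Real.sin θ ^ 2| ≤ 1 := by
    rw [abs_of_nonneg (sq_nonneg _)]; exact Real.sin_sq_le_one θ
  calc |pruferField w ν t θ| = |-((ν + w t ^ 2) * Real.cos θ ^ 2
        + w t * (2 * (Real.sin θ * Real.cos θ)) + Real.sin θ ^ 2)| := by
        unfold pruferField; congr 1; ring
    _ ≤ |ν + w t ^ 2| * |Real.cos θ ^ 2| + |w t| * |2 * (Real.sin θ * Real.cos θ)|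
        + |Real.sin θ ^ 2| := by
        rw [abs_neg, ← abs_mul, ← abs_mul]; exact abs_add_three _ _ _
    _ ≤ (|ν| + W ^ 2) * 1 + W * 1 + 1 := by gcongr
    _ ≤ _ := by nlinarith [abs_nonneg ν, sq_nonneg W]

theorem exists_isPruferAngle {a b : ℝ} (hab : a ≤ b) {w : ℝ → ℝ} (hw : ContinuousOn w (Icc a b))
    (ν : ℝ) : ∃ θ, IsPruferAngle a b w ν θ := by
  obtain ⟨W, hW⟩ := isCompact_Icc.exists_bound_of_continuousOn hw
  set K : NNReal := (2 * (|ν| + W ^ 2) + 4 * W + 2).toNNReal with hK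
  -- The field is bounded by `K` for all angles, so a solution moves by at most `K (b - a)`; a ball
  -- of that radius gives existence on all of `[a, b]`.
  have hPL : IsPicardLindelof (pruferField w ν) (⟨a, left_mem_Icc.2 hab⟩ : Icc a b) (0 : ℝ)
      (K * (b - a).toNNReal) 0 K K := by
    refine ⟨fun t ht => (lipschitzWith_pruferField (hW t ht)).lipschitzOnWith, fun x _ => ?_,
      fun t ht x _ => (abs_pruferField_le (hW t ht) x).trans (Real.le_coe_toNNReal _), ?_⟩
    · unfold pruferField
      fun_prop
    · simp [Real.coe_toNNReal _ (sub_nonneg.2 hab), hab]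
  obtain ⟨θ, h0, h1⟩ := hPL.exists_eq_forall_mem_Icc_hasDerivWithinAt₀
  exact ⟨θ, h0, h1⟩

/-- The final value of the Prüfer angle depends continuously on the spectral parameter. -/
theorem continuous_pruferAngle_right {a b : ℝ} (hab : a ≤ b) {w : ℝ → ℝ}
    (hw : ContinuousOn w (Icc a b)) {θ : ℝ → ℝ → ℝ} (hθ : ∀ ν, IsPruferAngle a b w ν (θ ν)) :
    Continuous fun ν => θ ν b := by
  obtain ⟨W, hW⟩ := isCompact_Icc.exists_bound_of_continuousOn hw
  rw [continuous_iff_continuousAt]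
  intro ν
  set K : NNReal := (2 * (|ν| + W ^ 2) + 4 * W + 2).toNNReal with hK
  have hright : ∀ κ, ∀ t ∈ Ico a b,
      HasDerivWithinAt (θ κ) (pruferField w κ t (θ κ t)) (Ici t) t := fun κ t ht =>
    ((hθ κ).hasDeriv t (Ico_subset_Icc_self ht)).mono_of_mem_nhdsWithin
      (Filter.mem_of_superset (Icc_mem_nhdsGE ht.2) (Icc_subset_Icc ht.1 le_rfl))
  have hdist : ∀ κ, dist (θ κ b) (θ ν b) ≤ gronwallBound 0 K |κ - ν| (b - a) := by
    intro κ
    -- Grönwall: `θ κ` solves the equation for `ν` up to an error `|κ - ν|`.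
    have := dist_le_of_approx_trajectories_ODE_of_mem (v := pruferField w ν) (K := K)
      (s := fun _ => univ) (f := θ κ) (g := θ ν) (εf := |κ - ν|) (εg := 0) (δ := 0)
      (f' := fun t => pruferField w κ t (θ κ t)) (g' := fun t => pruferField w ν t (θ ν t))
      (fun t ht => (lipschitzWith_pruferField (hW t (Ico_subset_Icc_self ht))).lipschitzOnWith)
      (hθ κ).continuousOn (hright κ) ?_ (fun _ _ => mem_univ _)
      (hθ ν).continuousOn (hright ν) (fun _ _ => by simp) (fun _ _ => mem_univ _)
      (by simp [(hθ κ).initial, (hθ ν).initial]) b (right_mem_Icc.2 hab)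
    · simpa using this
    · intro t _
      have : pruferField w κ t (θ κ t) - pruferField w ν t (θ κ t)
          = (ν - κ) * Real.cos (θ κ t) ^ 2 := by
        unfold pruferField; ring
      rw [Real.dist_eq, this, abs_mul, abs_sub_comm, abs_of_nonneg (sq_nonneg (Real.cos _))]
      exact mul_le_of_le_one_right (abs_nonneg _) (Real.cos_sq_le_one _)
  have hlim : Filter.Tendsto (fun κ => gronwallBound 0 K |κ - ν| (b - a)) (nhds ν) (nhds 0) := by
    have hc : Continuous fun κ : ℝ => gronwallBound 0 K |κ - ν| (b - a) :=
      (gronwallBound_continuous_ε 0 K (b - a)).comp (by fun_prop : Continuous fun κ => |κ - ν|)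
    simpa [gronwallBound_ε0_δ0] using hc.tendsto ν
  exact tendsto_iff_dist_tendsto_zero.2
    (squeeze_zero (fun _ => dist_nonneg) hdist hlim)

/-- At a zero of `y` neither `w` nor `ν` enters the field, so the angle crosses odd multiples of `π
/ 2` only downwards. -/
theorem pruferField_of_cos_eq_zero {w : ℝ → ℝ} {ν t θ : ℝ} (h : Real.cos θ = 0) :
    pruferField w ν t θ = -1 := by
  have := Real.sin_sq_add_cos_sq θ
  unfold pruferField
  rw [h] at this ⊢
  linarith

/-- The Prüfer angle stays below `π / 2`. -/
theorem IsPruferAngle.lt_pi_div_two {a b : ℝ} {w : ℝ → ℝ} {ν : ℝ} {θ : ℝ → ℝ}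
    (h : IsPruferAngle a b w ν θ) {x : ℝ} (hx : x ∈ Icc a b) : θ x < Real.pi / 2 := by
  by_contra! hge
  have := ge_of_ge_of_deriv_neg_on_level h.hasDeriv (c := Real.pi / 2)
    (fun t _ ht => by rw [pruferField_of_cos_eq_zero (by rw [ht, Real.cos_pi_div_two])]; norm_num)
    (left_mem_Icc.2 (hx.1.trans hx.2)) hx hx.1 hge
  rw [h.initial] at this
  linarith [Real.pi_pos]

/-- Once the Prüfer angle has reached `-π / 2`, it stays below. -/
theorem IsPruferAngle.right_le_neg_pi_div_two {a b : ℝ} {w : ℝ → ℝ} {ν : ℝ} {θ : ℝ → ℝ}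
    (h : IsPruferAngle a b w ν θ) {x : ℝ} (hx : x ∈ Icc a b) (hle : θ x ≤ -(Real.pi / 2)) :
    θ b ≤ -(Real.pi / 2) :=
  le_of_le_of_deriv_neg_on_level h.hasDeriv (c := -(Real.pi / 2))
    (fun t _ ht => by
      rw [pruferField_of_cos_eq_zero (by rw [ht, Real.cos_neg, Real.cos_pi_div_two])]; norm_num)
    hx (right_mem_Icc.2 (hx.1.trans hx.2)) hx.2 hle

/-- For very negative spectral parameter the Prüfer angle is nonnegative. -/
theorem IsPruferAngle.right_nonneg {a b : ℝ} (hab : a ≤ b) {w : ℝ → ℝ} {ν : ℝ} {θ : ℝ → ℝ}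
    (h : IsPruferAngle a b w ν θ) (hν : ∀ t ∈ Icc a b, ν + w t ^ 2 < 0) : 0 ≤ θ b := by
  -- At angle `0` the field equals `-(ν + w²) > 0`, so `-θ` cannot rise through `0`.
  have := le_of_le_of_deriv_neg_on_level (θ := fun t => -θ t) (c := 0)
    (fun t ht => (h.hasDeriv t ht).neg) (fun t ht h0 => ?_) (left_mem_Icc.2 hab)
    (right_mem_Icc.2 hab) hab (by simp [h.initial])
  · simpa using this
  · have h0 : θ t = 0 := by simpa using h0
    simpa [pruferField, h0] using hν t ht

/-- The Prüfer radius turns the angle into a solution of the first order system. -/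
theorem IsPruferAngle.exists_radius {a b : ℝ} (hab : a ≤ b) {w : ℝ → ℝ}
    (hw : ContinuousOn w (Icc a b)) {ν : ℝ} {θ : ℝ → ℝ} (h : IsPruferAngle a b w ν θ) :
    ∃ r : ℝ → ℝ, r a = 1 ∧ (∀ t, 0 < r t) ∧ ∀ t ∈ Icc a b,
      HasDerivWithinAt (fun s => r s * Real.cos (θ s))
        (r t * Real.sin (θ t) + w t * (r t * Real.cos (θ t))) (Icc a b) t ∧
      HasDerivWithinAt (fun s => r s * Real.sin (θ s))
        (-(ν + w t ^ 2) * (r t * Real.cos (θ t)) - w t * (r t * Real.sin (θ t))) (Icc a b) t := by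
  -- `ρ = (y y' + z z') / r²` is the logarithmic derivative of the radius.
  set ρ : ℝ → ℝ := fun t => w t * Real.cos (θ t) ^ 2
    + (1 - ν - w t ^ 2) * (Real.sin (θ t) * Real.cos (θ t)) - w t * Real.sin (θ t) ^ 2 with hρ
  have hθc := h.continuousOn
  have hρc : ContinuousOn ρ (Icc a b) := by
    have hc := Real.continuous_cos.comp_continuousOn hθc
    have hs := Real.continuous_sin.comp_continuousOn hθc
    simp only [Function.comp_def] at hc hs
    rw [hρ]
    fun_prop
  -- A continuous extension to the line lets the fundamental theorem apply at the endpoints too.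
  set ρe : ℝ → ℝ := IccExtend hab ((Icc a b).domRestrict ρ) with hρe
  have hρec : Continuous ρe := (continuousOn_iff_continuous_domRestrict.1 hρc).Icc_extend'
  refine ⟨fun t => Real.exp (∫ s in a..t, ρe s), by simp, fun t => Real.exp_pos _, ?_⟩
  intro t ht
  have hr : HasDerivWithinAt (fun t => Real.exp (∫ s in a..t, ρe s))
      (Real.exp (∫ s in a..t, ρe s) * ρ t) (Icc a b) t := by
    have h1 := (hρec.integral_hasStrictDerivAt a t).hasDerivAt.exp
    have h2 : ρe t = ρ t := by rw [hρe, IccExtend_of_mem _ _ ht]; rfl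
    rw [h2] at h1
    exact h1.hasDerivWithinAt
  have hcos := (h.hasDeriv t ht).cos
  have hsin := (h.hasDeriv t ht).sin
  have hcs : Real.sin (θ t) ^ 2 = 1 - Real.cos (θ t) ^ 2 := Real.sin_sq _
  refine ⟨?_, ?_⟩
  · refine (hr.mul hcos).congr_deriv ?_
    simp only [hρ, pruferField]
    generalize Real.exp _ = r
    generalize Real.sin (θ t) = S at *
    generalize Real.cos (θ t) = C at *
    linear_combination (w t * r * C + r * S) * hcs
  · refine (hr.mul hsin).congr_deriv ?_
    simp only [hρ, pruferField]
    generalize Real.exp _ = r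
    generalize Real.sin (θ t) = S at *
    generalize Real.cos (θ t) = C at *
    linear_combination (-r * (ν + w t ^ 2) * C - w t * r * S) * hcs

/-! ### Integration by parts; from the system to eigenfunctions -/

/-- Integration by parts for the product of an absolutely continuous function and a `C¹`
function. -/
theorem integral_mul_add_mul_eq {a b : ℝ} (hab : a ≤ b) {v w : ℝ → ℝ} (hv : IntervalIntegrable v volume a b)
    (hw : AbsolutelyContinuousOnInterval w a b)
    (hwv : ∀ᵐ t, t ∈ uIcc a b → HasDerivAt w (v t) t) {g g' : ℝ → ℝ}
    (hg : ∀ t ∈ Icc a b, HasDerivWithinAt g (g' t) (Icc a b) t) (hg' : ContinuousOn g' (Icc a b))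
    {x : ℝ} (hx : x ∈ Icc a b) :
    ∫ t in a..x, (v t * g t + w t * g' t) = w x * g x - w a * g a := by
  have hgc : ContinuousOn g (Icc a b) := fun t ht => (hg t ht).continuousWithinAt
  have hgac : AbsolutelyContinuousOnInterval g a b := by
    obtain ⟨C, hC⟩ := isCompact_Icc.exists_bound_of_continuousOn hg'
    have : LipschitzOnWith C.toNNReal g (Icc a b) :=
      (convex_Icc a b).lipschitzOnWith_of_nnnorm_hasDerivWithin_le hg fun t ht => by
        rw [← NNReal.coe_le_coe, coe_nnnorm]
        exact (hC t ht).trans (Real.le_coe_toNNReal _)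
    refine LipschitzOnWith.absolutelyContinuousOnInterval (K := C.toNNReal) ?_
    rwa [uIcc_of_le hab]
  have hwc : ContinuousOn w (Icc a b) := by
    simpa only [uIcc_of_le hab] using hw.continuousOn
  set h : ℝ → ℝ := fun t => v t * g t + w t * g' t with hh
  have hint : IntervalIntegrable h volume a b :=
    (hv.mul_continuousOn (by rwa [uIcc_of_le hab])).add
      ((hwc.mul hg').intervalIntegrable_of_Icc hab)
  have hmul : AbsolutelyContinuousOnInterval (w * g) a b := hw.mul hgac
  have hprim : AbsolutelyContinuousOnInterval (fun t => ∫ s in a..t, h s) a b :=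
    hint.absolutelyContinuousOnInterval_intervalIntegral left_mem_uIcc
  -- This difference is absolutely continuous with derivative zero almost everywhere, hence
  -- constant.
  have hdac : AbsolutelyContinuousOnInterval
      (fun t => w t * g t - ∫ s in a..t, h s) a b := hmul.sub hprim
  have hderiv : ∀ᵐ t, t ∈ uIcc a b →
      HasDerivAt (fun t => w t * g t - ∫ s in a..t, h s) 0 t := by
    have h1 : ∀ᵐ x : ℝ, x ≠ a := by simp [ae_iff, measure_singleton]
    have h2 : ∀ᵐ x : ℝ, x ≠ b := by simp [ae_iff, measure_singleton]
    filter_upwards [hwv, hint.ae_hasDerivAt_integral, h1, h2] with t hw hi hta htb ht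
    have ht' : t ∈ Icc a b := by rwa [uIcc_of_le hab] at ht
    have hg0 : HasDerivAt g (g' t) t := (hg t ht').hasDerivAt
      (Icc_mem_nhds (lt_of_le_of_ne ht'.1 hta.symm) (lt_of_le_of_ne ht'.2 htb))
    refine (((hw ht).fun_mul hg0).fun_sub (hi ht a left_mem_uIcc)).congr_deriv ?_
    rw [hh]
    ring
  obtain ⟨C, hC⟩ := hdac.const_of_ae_hasDerivAt_zero hderiv
  rw [uIcc_of_le hab] at hC
  have hCa : w a * g a - ∫ s in a..a, h s = C := hC a (left_mem_Icc.2 hab)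
  have hCx : w x * g x - ∫ s in a..x, h s = C := hC x hx
  rw [intervalIntegral.integral_same, sub_zero] at hCa
  rw [hCa, ← hCx]
  abel

/-- Integration by parts for the product of an indefinite integral and a `C¹` function. -/
theorem integral_mul_eq {a b : ℝ} (hab : a ≤ b) {v : ℝ → ℝ} (hv : IntervalIntegrable v volume a b) {g g' : ℝ → ℝ}
    (hg : ∀ t ∈ Icc a b, HasDerivWithinAt g (g' t) (Icc a b) t) (hg' : ContinuousOn g' (Icc a b))
    {x : ℝ} (hx : x ∈ Icc a b) :
    (∫ t in a..x, v t) * g x = ∫ t in a..x, (v t * g t + (∫ s in a..t, v s) * g' t) := by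
  have := integral_mul_add_mul_eq hab hv (w := fun t => ∫ s in a..t, v s)
    (hv.absolutelyContinuousOnInterval_intervalIntegral left_mem_uIcc)
    (by filter_upwards [hv.ae_hasDerivAt_integral] with t h ht using h ht a left_mem_uIcc)
    hg hg' hx
  simpa using this.symm

/-- Integration by parts for the product of an indefinite integral and a complex `C¹` function. -/
theorem integral_mul_eq_complex {a b : ℝ} (hab : a ≤ b) {v : ℝ → ℝ}
    (hv : IntervalIntegrable v volume a b) {g g' : ℝ → ℂ}
    (hg : ∀ t ∈ Icc a b, HasDerivWithinAt g (g' t) (Icc a b) t) (hg' : ContinuousOn g' (Icc a b))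
    {x : ℝ} (hx : x ∈ Icc a b) :
    ((∫ t in a..x, v t : ℝ) : ℂ) * g x
      = ∫ t in a..x, ((v t : ℂ) * g t + ((∫ s in a..t, v s : ℝ) : ℂ) * g' t) := by
  have hgc : ContinuousOn g (Icc a b) := fun t ht => (hg t ht).continuousWithinAt
  have hwc : ContinuousOn (fun t => ∫ s in a..t, v s) (Icc a b) := by
    simpa only [uIcc_of_le hab] using
      (hv.absolutelyContinuousOnInterval_intervalIntegral (c := a) left_mem_uIcc).continuousOn
  have hsub : Icc a x ⊆ Icc a b := Icc_subset_Icc le_rfl hx.2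
  have hint : IntervalIntegrable
      (fun t => (v t : ℂ) * g t + ((∫ s in a..t, v s : ℝ) : ℂ) * g' t) volume a x := by
    have hvx : IntervalIntegrable (fun t => (v t : ℂ)) volume a x := by
      have := hv.mono_set (c := a) (d := x)
        (by rw [uIcc_of_le hx.1, uIcc_of_le hab]; exact hsub)
      exact ⟨this.1.ofReal, this.2.ofReal⟩
    refine (hvx.mul_continuousOn ?_).add ?_
    · rw [uIcc_of_le hx.1]
      exact hgc.mono hsub
    · refine ContinuousOn.intervalIntegrable_of_Icc hx.1 (ContinuousOn.mono ?_ hsub)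
      exact (Complex.continuous_ofReal.comp_continuousOn hwc).mul hg'
  have hre := integral_mul_eq hab hv (g := fun t => (g t).re) (g' := fun t => (g' t).re)
    (fun t ht => Complex.reCLM.hasFDerivAt.comp_hasDerivWithinAt t (hg t ht))
    (Complex.continuous_re.comp_continuousOn hg') hx
  have him := integral_mul_eq hab hv (g := fun t => (g t).im) (g' := fun t => (g' t).im)
    (fun t ht => Complex.imCLM.hasFDerivAt.comp_hasDerivWithinAt t (hg t ht))
    (Complex.continuous_im.comp_continuousOn hg') hx
  have hre' := Complex.reCLM.intervalIntegral_comp_comm hint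
  have him' := Complex.imCLM.intervalIntegral_comp_comm hint
  simp only [Complex.reCLM_apply, Complex.imCLM_apply, Complex.add_re, Complex.add_im,
    Complex.re_ofReal_mul, Complex.im_ofReal_mul] at hre' him'
  refine Complex.ext ?_ ?_
  · rw [Complex.re_ofReal_mul, hre, hre']
  · rw [Complex.im_ofReal_mul, him, him']

theorem intervalIntegrable_of_memLp_top {v : ℝ → ℝ} (hv : MemLp v ⊤ volume) (c d : ℝ) :
    IntervalIntegrable v volume c d :=
  ((hv.locallyIntegrable le_top).integrableOn_isCompact isCompact_uIcc).intervalIntegrable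

/-- The derivative `z + w y` of the first component of the system, as an indefinite integral. -/
theorem system_deriv_eq_integral {a b : ℝ} (hab : a ≤ b) {v : ℝ → ℝ}
    (hvi : ∀ c d, IntervalIntegrable v volume c d) {ν : ℝ} {y z : ℝ → ℝ}
    (hy : ∀ t ∈ Icc a b, HasDerivWithinAt y (z t + (∫ s in a..t, v s) * y t) (Icc a b) t)
    (hz : ∀ t ∈ Icc a b, HasDerivWithinAt z
      (-(ν + (∫ s in a..t, v s) ^ 2) * y t - (∫ s in a..t, v s) * z t) (Icc a b) t)
    (hz0 : z a = 0) {x : ℝ} (hx : x ∈ Icc a b) :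
    z x + (∫ s in a..x, v s) * y x = ∫ t in a..x, (v t - ν) * y t := by
  have hwc : Continuous fun t => ∫ s in a..t, v s := intervalIntegral.continuous_primitive hvi a
  have hyc : ContinuousOn y (Icc a b) := fun t ht => (hy t ht).continuousWithinAt
  have hzc : ContinuousOn z (Icc a b) := fun t ht => (hz t ht).continuousWithinAt
  have hy'c : ContinuousOn (fun t => z t + (∫ s in a..t, v s) * y t) (Icc a b) :=
    hzc.add (hwc.continuousOn.mul hyc)
  have hz'c : ContinuousOn
      (fun t => -(ν + (∫ s in a..t, v s) ^ 2) * y t - (∫ s in a..t, v s) * z t) (Icc a b) := by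
    have := hwc.continuousOn (s := Icc a b)
    fun_prop
  have hsub : Icc a x ⊆ Icc a b := Icc_subset_Icc le_rfl hx.2
  have hzx : ∫ t in a..x, (-(ν + (∫ s in a..t, v s) ^ 2) * y t - (∫ s in a..t, v s) * z t)
      = z x - z a := intervalIntegral.integral_eq_sub_of_hasDeriv_right_of_le hx.1
        (hzc.mono hsub) (fun t ht => ((hz t (hsub (Ioo_subset_Icc_self ht))).hasDerivAt
          (Icc_mem_nhds ht.1 (ht.2.trans_le hx.2))).hasDerivWithinAt)
        ((hz'c.mono hsub).intervalIntegrable_of_Icc hx.1)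
  have hwy := integral_mul_eq hab (hvi a b) hy hy'c hx
  rw [hz0, sub_zero] at hzx
  -- In `z' + v y + w (z + w y)` the terms in `w` cancel, leaving `(v - ν) y`.
  rw [← hzx, hwy, ← intervalIntegral.integral_add]
  · congr 1
    ext t
    ring
  · exact (hz'c.mono hsub).intervalIntegrable_of_Icc hx.1
  · refine ((hvi a x).mul_continuousOn ?_).add ?_
    · rw [uIcc_of_le hx.1]; exact hyc.mono hsub
    · exact ((hwc.continuousOn.mul hy'c).mono hsub).intervalIntegrable_of_Icc hx.1

/-- A solution of the first order system whose quasi-derivative matches the Neumann condition at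
the right endpoint is an eigenfunction. -/
theorem isEigenvalue_of_system {v : ℝ → ℝ} {L ν : ℝ} (hL : 0 < L) (hv : MemLp v ⊤ volume)
    {y z : ℝ → ℝ}
    (hy : ∀ t ∈ Icc (-(L / 2)) (L / 2),
      HasDerivWithinAt y (z t + (∫ s in (-(L / 2))..t, v s) * y t) (Icc (-(L / 2)) (L / 2)) t)
    (hz : ∀ t ∈ Icc (-(L / 2)) (L / 2), HasDerivWithinAt z
      (-(ν + (∫ s in (-(L / 2))..t, v s) ^ 2) * y t - (∫ s in (-(L / 2))..t, v s) * z t)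
      (Icc (-(L / 2)) (L / 2)) t)
    (hz0 : z (-(L / 2)) = 0) (hzL : z (L / 2) + (∫ s in (-(L / 2))..(L / 2), v s) * y (L / 2) = 0)
    (hne : ∃ x ∈ interval L, y x ≠ 0) : IsEigenvalue v L ν := by
  set a := -(L / 2) with ha
  set b := L / 2 with hb
  have hab : a ≤ b := by rw [ha, hb]; linarith
  have hvi : ∀ c d, IntervalIntegrable v volume c d := intervalIntegrable_of_memLp_top hv
  have hyc : ContinuousOn y (Icc a b) := fun t ht => (hy t ht).continuousWithinAt
  have hf1 : ∀ x ∈ Icc a b, z x + (∫ s in a..x, v s) * y x = ∫ t in a..x, (v t - ν) * y t :=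
    fun x hx => system_deriv_eq_integral hab hvi hy hz hz0 hx
  -- The weak second derivative is `(v - ν) y`, a product of bounded functions and so in `L²`.
  refine ⟨fun x => (y x : ℂ), fun x => ((z x + (∫ s in a..x, v s) * y x : ℝ) : ℂ),
    fun x => (((v x - ν) * y x : ℝ) : ℂ), ⟨?_, ?_, ?_, ?_, ?_⟩, ?_, ?_⟩
  · have hsub : interval L ⊆ Icc a b := Ioo_subset_Icc_self
    have : IsFiniteMeasure (volume.restrict (interval L)) :=
      ⟨by simp [interval]⟩
    have hyt : MemLp y ⊤ (volume.restrict (interval L)) := by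
      obtain ⟨C, hC⟩ := isCompact_Icc.exists_bound_of_continuousOn hyc
      refine memLp_top_of_bound
        ((hyc.mono hsub).aestronglyMeasurable measurableSet_Ioo) C ?_
      filter_upwards [ae_restrict_mem measurableSet_Ioo] with t ht using hC t (hsub ht)
    have hvt : MemLp (fun x => v x - ν) ⊤ (volume.restrict (interval L)) :=
      (hv.restrict _).sub (memLp_const ν)
    have : MemLp (fun x => (v x - ν) * y x) ⊤ (volume.restrict (interval L)) := hyt.mul' hvt
    exact (this.mono_exponent le_top).ofReal
  · intro t ht
    exact (hy t ht).ofReal_comp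
  · intro x hx
    have h0 := hf1 a (left_mem_Icc.2 hab)
    rw [intervalIntegral.integral_same (f := fun t => (v t - ν) * y t)] at h0
    change ((z x + (∫ s in a..x, v s) * y x : ℝ) : ℂ)
      = ((z a + (∫ s in a..a, v s) * y a : ℝ) : ℂ) + ∫ t in a..x, (((v t - ν) * y t : ℝ) : ℂ)
    rw [h0, hf1 x hx, intervalIntegral.integral_ofReal, Complex.ofReal_zero, zero_add]
  · change ((z a + (∫ s in a..a, v s) * y a : ℝ) : ℂ) = 0
    rw [hz0, intervalIntegral.integral_same, zero_mul, add_zero, Complex.ofReal_zero]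
  · change ((z b + (∫ s in a..b, v s) * y b : ℝ) : ℂ) = 0
    rw [hzL, Complex.ofReal_zero]
  · obtain ⟨x, hx, hx0⟩ := hne
    exact ⟨x, hx, by simpa using hx0⟩
  · refine Filter.Eventually.of_forall fun x => ?_
    push_cast
    ring

/-! ### Shooting for a lower eigenvalue -/

/-- If the Prüfer angle of `μ` reaches `-π / 2`, there is an eigenvalue below `μ`. -/
theorem exists_isEigenvalue_lt {v : ℝ → ℝ} {L μ : ℝ} (hL : 0 < L) (hv : MemLp v ⊤ volume)
    (hw0 : 0 ≤ ∫ s in (-(L / 2))..(L / 2), v s) {θ₀ : ℝ → ℝ}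
    (hθ₀ : IsPruferAngle (-(L / 2)) (L / 2) (fun t => ∫ s in (-(L / 2))..t, v s) μ θ₀)
    (hle : θ₀ (L / 2) ≤ -(Real.pi / 2)) : ∃ ν < μ, IsEigenvalue v L ν := by
  set a := -(L / 2) with ha
  set b := L / 2 with hb
  have hab : a ≤ b := by rw [ha, hb]; linarith
  set w : ℝ → ℝ := fun t => ∫ s in a..t, v s with hwdef
  have hwc : Continuous w := intervalIntegral.continuous_primitive
    (intervalIntegrable_of_memLp_top hv) a
  obtain ⟨W, hW⟩ := isCompact_Icc.exists_bound_of_continuousOn (hwc.continuousOn (s := Icc a b))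
  choose θ' hθ' using exists_isPruferAngle hab (hwc.continuousOn (s := Icc a b))
  -- The chosen family is made to agree with the given angle at `μ`, which avoids a uniqueness
  -- argument.
  set θ : ℝ → ℝ → ℝ := Function.update θ' μ θ₀ with hθdef
  have hθ : ∀ ν, IsPruferAngle a b w ν (θ ν) := by
    intro ν
    rcases eq_or_ne ν μ with rfl | hne
    · simpa [hθdef] using hθ₀
    · simpa [hθdef, Function.update_of_ne hne] using hθ' ν
  have hμ : θ μ b ≤ -(Real.pi / 2) := by simpa [hθdef] using hle
  -- The Neumann condition `z b + w b * y b = 0` says `tan θ = -w b`; `α` is its solution in `(-π/2,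
  -- 0]`.
  set α := -Real.arctan (w b) with hα
  have hα1 : -(Real.pi / 2) < α := neg_lt_neg (Real.arctan_lt_pi_div_two _)
  have hα2 : α ≤ 0 := neg_nonpos.2 (Real.arctan_nonneg.2 hw0)
  -- Low enough for `ν₀ + w² < 0` on `[a, b]`, and not above `μ`.
  set ν₀ := min μ (-(W ^ 2) - 1) with hν₀
  have h0 : 0 ≤ θ ν₀ b := (hθ ν₀).right_nonneg hab fun t ht => by
    have h1 : w t ^ 2 ≤ W ^ 2 := by
      rw [← sq_abs]
      exact pow_le_pow_left₀ (abs_nonneg _) (hW t ht) 2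
    linarith [min_le_right μ (-(W ^ 2) - 1)]
  obtain ⟨ν, hν, hνα⟩ := intermediate_value_Icc' (min_le_left μ (-(W ^ 2) - 1))
    (continuous_pruferAngle_right hab hwc.continuousOn hθ).continuousOn
    (⟨hμ.trans hα1.le, hα2.trans h0⟩ : α ∈ Icc (θ μ b) (θ ν₀ b))
  have hνμ : ν ≠ μ := by
    rintro rfl
    simp only at hνα
    linarith
  refine ⟨ν, lt_of_le_of_ne hν.2 hνμ, ?_⟩
  obtain ⟨r, hr1, hrpos, hr⟩ := (hθ ν).exists_radius hab hwc.continuousOn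
  have hcpos : 0 < Real.cos (θ ν b) := by
    rw [show θ ν b = α from hνα, hα, Real.cos_neg]
    exact Real.cos_arctan_pos _
  refine isEigenvalue_of_system hL hv (fun t ht => (hr t ht).1) (fun t ht => (hr t ht).2) ?_ ?_ ?_
  · rw [← ha, (hθ ν).initial, Real.sin_zero, mul_zero]
  · change r b * Real.sin (θ ν b) + w b * (r b * Real.cos (θ ν b)) = 0
    have hs : Real.sin (θ ν b) = -(w b * Real.cos (θ ν b)) := by
      rw [show θ ν b = α from hνα, hα, Real.cos_neg, Real.sin_neg]
      conv_lhs => rw [← Real.tan_mul_cos (Real.cos_arctan_pos (w b)).ne', Real.tan_arctan]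
    rw [hs]
    ring
  -- `y` is nonzero at `b`, which lies outside the open interval; continuity supplies an interior
  -- point.
  · have hcont : ContinuousWithinAt (fun t => r t * Real.cos (θ ν t)) (Icc a b) b :=
      (hr b (right_mem_Icc.2 hab)).1.continuousWithinAt
    have hev := hcont.tendsto.eventually_ne (mul_pos (hrpos b) hcpos).ne'
    have hlt : a < b := by rw [ha, hb]; linarith
    have hmono : nhdsWithin b (Ioo a b) ≤ nhdsWithin b (Icc a b) :=
      nhdsWithin_mono _ Ioo_subset_Icc_self
    have : (nhdsWithin b (Ioo a b)).NeBot := right_nhdsWithin_Ioo_neBot hlt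
    obtain ⟨x, hx, hxI⟩ := ((hev.filter_mono hmono).and self_mem_nhdsWithin).exists
    exact ⟨x, hxI, hx⟩

/-! ### From eigenfunctions to the system; positivity of the ground state -/

/-- The fundamental theorem of calculus on a closed interval, with one-sided derivatives at the
endpoints. -/
theorem hasDerivWithinAt_of_eq_integral {E : Type*} [NormedAddCommGroup E] [NormedSpace ℝ E]
    [CompleteSpace E] {a b : ℝ} {F G : ℝ → E} (hG : ContinuousOn G (Icc a b))
    (hF : ∀ x ∈ Icc a b, F x = ∫ t in a..x, G t) {x : ℝ} (hx : x ∈ Icc a b) :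
    HasDerivWithinAt F (G x) (Icc a b) x := by
  have hab : a ≤ b := hx.1.trans hx.2
  set Ge : ℝ → E := IccExtend hab ((Icc a b).domRestrict G) with hGe
  have hGec : Continuous Ge := (continuousOn_iff_continuous_domRestrict.1 hG).Icc_extend'
  have hGeq : ∀ t ∈ Icc a b, Ge t = G t := fun t ht => by rw [hGe, IccExtend_of_mem _ _ ht]; rfl
  have h1 := (hGec.integral_hasStrictDerivAt a x).hasDerivAt.hasDerivWithinAt (s := Icc a b)
  rw [hGeq x hx] at h1
  refine h1.congr_of_mem (fun t ht => ?_) hx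
  rw [hF t ht]
  refine intervalIntegral.integral_congr fun s hs => ?_
  rw [uIcc_of_le ht.1] at hs
  exact (hGeq s ⟨hs.1, hs.2.trans ht.2⟩).symm

theorem eq_left_of_hasDerivWithinAt_zero {E : Type*} [NormedAddCommGroup E] [NormedSpace ℝ E]
    {a b : ℝ} {F : ℝ → E} (hF : ∀ x ∈ Icc a b, HasDerivWithinAt F 0 (Icc a b) x) {x : ℝ}
    (hx : x ∈ Icc a b) : F x = F a :=
  constant_of_has_deriv_right_zero (fun t ht => (hF t ht).continuousWithinAt)
    (fun t ht => (hF t (Ico_subset_Icc_self ht)).mono_of_mem_nhdsWithin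
      (Filter.mem_of_superset (Icc_mem_nhdsGE ht.2) (Icc_subset_Icc ht.1 le_rfl))) x hx

/-- The quasi-derivative `f' - w f` of an eigenfunction is continuously differentiable. -/
theorem hasDerivWithinAt_quasiDeriv {v : ℝ → ℝ} {L μ : ℝ} (hL : 0 < L)
    (hv : MemLp v ⊤ volume) {f f₁ f₂ : ℝ → ℂ} (hf : InDomain L f f₁ f₂)
    (heq : ∀ᵐ x ∂(volume.restrict (interval L)), -f₂ x + (v x : ℂ) * f x = (μ : ℂ) * f x)
    {x : ℝ} (hx : x ∈ Icc (-(L / 2)) (L / 2)) :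
    HasDerivWithinAt (fun x => f₁ x - ((∫ s in (-(L / 2))..x, v s : ℝ) : ℂ) * f x)
      (-μ * f x - ((∫ s in (-(L / 2))..x, v s : ℝ) : ℂ) * f₁ x) (Icc (-(L / 2)) (L / 2)) x := by
  obtain ⟨hmem, hd, hde, hn, -⟩ := hf
  unfold interval at hmem heq
  generalize ha : -(L / 2) = a at *
  generalize hb : L / 2 = b at *
  have hab : a ≤ b := by linarith
  have hvi := intervalIntegrable_of_memLp_top hv
  have hf2 : IntervalIntegrable f₂ volume a b := by
    rw [intervalIntegrable_iff_integrableOn_Ioo_of_le hab]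
    have : IsFiniteMeasure (volume.restrict (Ioo a b)) := ⟨by simp⟩
    exact hmem.integrable (by norm_num)
  have hfc : ContinuousOn f (Icc a b) := fun t ht => (hd t ht).continuousWithinAt
  have hwc : Continuous fun t => ∫ s in a..t, v s := intervalIntegral.continuous_primitive hvi a
  have hwcc : Continuous fun t => ((∫ s in a..t, v s : ℝ) : ℂ) :=
    Complex.continuous_ofReal.comp hwc
  have hf1c : ContinuousOn f₁ (Icc a b) := by
    have h := intervalIntegral.continuousOn_primitive_interval' hf2 left_mem_uIcc
    rw [uIcc_of_le hab] at h
    exact (continuousOn_const.add h).congr hde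
  have hGc : ContinuousOn (fun t => -(μ : ℂ) * f t - ((∫ s in a..t, v s : ℝ) : ℂ) * f₁ t)
      (Icc a b) := by
    have := hwcc.continuousOn (s := Icc a b)
    fun_prop
  refine hasDerivWithinAt_of_eq_integral hGc (fun x hx => ?_) hx
  have hsub : Icc a x ⊆ Icc a b := Icc_subset_Icc le_rfl hx.2
  -- Integration by parts writes `w f` as `∫ (v f + w f₁)`; subtracted from `∫ f₂`, it leaves `f₂ -
  -- v f = -μ f`, so the rough potential disappears.
  rw [hde x hx, hn, zero_add, integral_mul_eq_complex hab (hvi a b) hd hf1c hx,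
    ← intervalIntegral.integral_sub]
  · refine intervalIntegral.integral_congr_ae ?_
    have hne : ∀ᵐ t : ℝ, t ≠ b := by simp [ae_iff, measure_singleton]
    filter_upwards [(ae_restrict_iff' measurableSet_Ioo).1 heq, hne] with t ht htb hmt
    rw [uIoc_of_le hx.1] at hmt
    have := ht ⟨hmt.1, lt_of_le_of_ne (hmt.2.trans hx.2) htb⟩
    linear_combination -this
  · exact hf2.mono_set (by rw [uIcc_of_le hx.1, uIcc_of_le hab]; exact hsub)
  · refine IntervalIntegrable.add (IntervalIntegrable.mul_continuousOn ?_ ?_) ?_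
    · exact ⟨(hvi a x).1.ofReal, (hvi a x).2.ofReal⟩
    · rw [uIcc_of_le hx.1]
      exact hfc.mono hsub
    · exact ((hwcc.continuousOn.mul hf1c).mono hsub).intervalIntegrable_of_Icc hx.1

/-- The solution of the first order system for the smallest eigenvalue is positive. -/
theorem exists_pos_system_of_isLeast {v : ℝ → ℝ} {L μ : ℝ} (hL : 0 < L) (hv : MemLp v ⊤ volume)
    (hw0 : 0 ≤ ∫ s in (-(L / 2))..(L / 2), v s) (hμ : IsLeast {ν : ℝ | IsEigenvalue v L ν} μ) :
    ∃ y z : ℝ → ℝ, z (-(L / 2)) = 0 ∧ ∀ t ∈ Icc (-(L / 2)) (L / 2), 0 < y t ∧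
      HasDerivWithinAt y (z t + (∫ s in (-(L / 2))..t, v s) * y t) (Icc (-(L / 2)) (L / 2)) t ∧
      HasDerivWithinAt z
        (-(μ + (∫ s in (-(L / 2))..t, v s) ^ 2) * y t - (∫ s in (-(L / 2))..t, v s) * z t)
        (Icc (-(L / 2)) (L / 2)) t := by
  have hab : -(L / 2) ≤ L / 2 := by linarith
  have hwc : Continuous fun t => ∫ s in (-(L / 2))..t, v s :=
    intervalIntegral.continuous_primitive (intervalIntegrable_of_memLp_top hv) _
  obtain ⟨θ, hθ⟩ := exists_isPruferAngle hab (hwc.continuousOn) μ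
  obtain ⟨r, -, hr, hsys⟩ := hθ.exists_radius hab hwc.continuousOn
  refine ⟨fun t => r t * Real.cos (θ t), fun t => r t * Real.sin (θ t), ?_, fun t ht =>
    ⟨mul_pos (hr t) (Real.cos_pos_of_mem_Ioo ⟨?_, hθ.lt_pi_div_two ht⟩), hsys t ht⟩⟩
  · simp only [hθ.initial, Real.sin_zero, mul_zero]
  · by_contra! hle
    obtain ⟨ν, hlt, hν⟩ := exists_isEigenvalue_lt hL hv hw0 hθ (hθ.right_le_neg_pi_div_two ht hle)
    exact absurd (hμ.2 hν) (not_le.2 hlt)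

/-- Two solutions of the first order system with the same Neumann initial condition are
proportional if one of them is positive. -/
theorem exists_eq_const_mul_of_system {a b μ : ℝ} {w y z : ℝ → ℝ} {f f₁ : ℝ → ℂ}
    (hy0 : ∀ t ∈ Icc a b, 0 < y t)
    (hy : ∀ t ∈ Icc a b, HasDerivWithinAt y (z t + w t * y t) (Icc a b) t)
    (hz : ∀ t ∈ Icc a b, HasDerivWithinAt z (-(μ + w t ^ 2) * y t - w t * z t) (Icc a b) t)
    (hf : ∀ t ∈ Icc a b, HasDerivWithinAt f (f₁ t) (Icc a b) t)
    (hf₁ : ∀ t ∈ Icc a b, HasDerivWithinAt (fun t => f₁ t - w t * f t)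
      (-μ * f t - w t * f₁ t) (Icc a b) t)
    (hz0 : z a = 0) (hf0 : f₁ a - w a * f a = 0) :
    ∃ c : ℂ, ∀ t ∈ Icc a b, f t = c * y t ∧ f₁ t - w t * f t = c * z t := by
  -- The Wronskian is constant and vanishes at `a`.
  have hwr : ∀ t ∈ Icc a b, f t * z t - (f₁ t - w t * f t) * y t = 0 := by
    intro t ht
    have := eq_left_of_hasDerivWithinAt_zero
      (F := fun t => f t * (z t : ℂ) - (f₁ t - w t * f t) * y t) (a := a) (b := b) (fun t ht => by
        refine (((hf t ht).mul (hz t ht).ofReal_comp).sub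
          ((hf₁ t ht).mul (hy t ht).ofReal_comp)).congr_deriv ?_
        push_cast
        ring) ht
    simpa [hz0, hf0] using this
  -- The derivative of `f / y` is minus the Wronskian over `y²`.
  have hdiv : ∀ t ∈ Icc a b, f t / y t = f a / y a := by
    intro t ht
    refine eq_left_of_hasDerivWithinAt_zero (F := fun t => f t / (y t : ℂ)) (a := a) (b := b)
      (fun t ht => ?_) ht
    have hne : (y t : ℂ) ≠ 0 := by exact_mod_cast (hy0 t ht).ne'
    refine ((hf t ht).div (hy t ht).ofReal_comp hne).congr_deriv ?_
    rw [div_eq_zero_iff]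
    left
    push_cast
    linear_combination -(hwr t ht)
  refine ⟨f a / y a, fun t ht => ?_⟩
  have hne : (y t : ℂ) ≠ 0 := by exact_mod_cast (hy0 t ht).ne'
  have h1 : f t = f a / y a * y t := by rw [← hdiv t ht, div_mul_cancel₀ _ hne]
  refine ⟨h1, mul_right_cancel₀ hne ?_⟩
  have h2 := hwr t ht
  generalize f₁ t - w t * f t = p at *
  linear_combination (-1 : ℂ) * h2 + (z t : ℂ) * h1

/-! ### Harnack inequality -/

/-- A Neumann eigenvalue with positive eigenfunction is nonnegative if the potential is. -/
theorem nonneg_of_integral_eq_zero {a b : ℝ} (hab : a < b) {v y : ℝ → ℝ} {μ : ℝ}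
    (hvi : IntervalIntegrable v volume a b) (hv0 : 0 ≤ᵐ[volume] v)
    (hyc : ContinuousOn y (Icc a b)) (hy0 : ∀ t ∈ Icc a b, 0 < y t)
    (h : ∫ t in a..b, (v t - μ) * y t = 0) : 0 ≤ μ := by
  by_contra! hμ
  have hyi : IntervalIntegrable y volume a b := hyc.intervalIntegrable_of_Icc hab.le
  have hpos : 0 < ∫ t in a..b, y t :=
    intervalIntegral.intervalIntegral_pos_of_pos_on hyi
      (fun t ht => hy0 t (Ioo_subset_Icc_self ht)) hab
  -- If `μ < 0`, the vanishing integral would dominate `-μ ∫ y > 0`.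
  have hle : ∫ t in a..b, -μ * y t ≤ ∫ t in a..b, (v t - μ) * y t := by
    refine intervalIntegral.integral_mono_ae_restrict hab.le (hyi.const_mul _) ?_ ?_
    · refine (hvi.sub (intervalIntegrable_const)).mul_continuousOn ?_
      rwa [uIcc_of_le hab.le]
    · filter_upwards [ae_restrict_mem measurableSet_Icc, ae_restrict_of_ae hv0] with t ht hvt
      have hvt : 0 ≤ v t := hvt
      nlinarith [mul_nonneg hvt (hy0 t ht).le]
  rw [h, intervalIntegral.integral_const_mul] at hle
  nlinarith

/-- Harnack inequality for positive Neumann solutions with nonnegative spectral parameter. -/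
theorem le_exp_mul_of_system {a b μ : ℝ} {w y z : ℝ → ℝ} (hμ : 0 ≤ μ)
    (hw : MonotoneOn w (Icc a b)) (hwa : w a = 0)
    (hy0 : ∀ t ∈ Icc a b, 0 < y t)
    (hy : ∀ t ∈ Icc a b, HasDerivWithinAt y (z t + w t * y t) (Icc a b) t)
    (hz : ∀ t ∈ Icc a b, HasDerivWithinAt z (-(μ + w t ^ 2) * y t - w t * z t) (Icc a b) t)
    (hz0 : z a = 0) (hzb : z b + w b * y b = 0) {s t : ℝ} (hs : s ∈ Icc a b) (ht : t ∈ Icc a b) :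
    y s ≤ Real.exp (w b * (b - a)) * y t := by
  have hab : a ≤ b := hs.1.trans hs.2
  have ham := left_mem_Icc.2 hab
  have hbm := right_mem_Icc.2 hab
  -- Riccati equation for `q = z / y`; its right side is nonpositive because `μ ≥ 0`.
  have hq : ∀ t ∈ Icc a b, HasDerivWithinAt (fun t => z t / y t)
      (-μ - (z t / y t + w t) ^ 2) (Icc a b) t := by
    intro t ht
    have hne := (hy0 t ht).ne'
    refine ((hz t ht).div (hy t ht) hne).congr_deriv ?_
    field_simp
    ring
  have hanti : AntitoneOn (fun t => z t / y t) (Icc a b) :=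
    antitoneOn_of_hasDerivWithinAt_nonpos (convex_Icc a b)
      (fun t ht => (hq t ht).continuousWithinAt)
      (fun t ht => (hq t (interior_subset ht)).mono interior_subset)
      (fun t _ => by nlinarith [sq_nonneg (z t / y t + w t)])
  have hqb : z b / y b = -w b := by
    rw [div_eq_iff (hy0 b hbm).ne']
    linarith
  -- The quotient is `q + w` with `-w b ≤ q ≤ 0` and `0 ≤ w ≤ w b`.
  have hbound : ∀ t ∈ Icc a b, ‖(z t + w t * y t) / y t‖ ≤ w b := by
    intro t ht
    have hq1 : z t / y t ≤ z a / y a := hanti ham ht ht.1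
    have hq2 : z b / y b ≤ z t / y t := hanti ht hbm ht.2
    have hw1 := hw ham ht ht.1
    have hw2 := hw ht hbm ht.2
    rw [hz0, zero_div] at hq1
    rw [add_div, mul_div_cancel_right₀ _ (hy0 t ht).ne', Real.norm_eq_abs, abs_le]
    constructor <;> linarith
  have hlog := (convex_Icc a b).norm_image_sub_le_of_norm_hasDerivWithin_le
    (fun t ht => (hy t ht).log (hy0 t ht).ne') hbound ht hs
  have hst : ‖s - t‖ ≤ b - a := by
    rw [Real.norm_eq_abs, abs_le]
    constructor <;> linarith [hs.1, hs.2, ht.1, ht.2]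
  have hwb : 0 ≤ w b := hwa ▸ hw ham hbm hab
  have hle : Real.log (y s) ≤ w b * (b - a) + Real.log (y t) := by
    have h1 := (le_abs_self _).trans hlog
    have h2 := mul_le_mul_of_nonneg_left hst hwb
    linarith
  rw [← Real.exp_log (hy0 s hs), ← Real.exp_log (hy0 t ht), ← Real.exp_add]
  exact Real.exp_le_exp.2 hle

/-- Harnack inequality for ground states. -/
theorem norm_le_exp_mul_norm_of_isLeast {v : ℝ → ℝ} {L μ : ℝ} {φ : ℝ → ℂ} (hL : 0 < L)
    (hv : MemLp v ⊤ volume) (hv0 : 0 ≤ᵐ[volume] v)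
    (hμ : IsLeast {ν : ℝ | IsEigenvalue v L ν} μ) (hφ : IsEigenfunction v L μ φ) {s t : ℝ}
    (hs : s ∈ interval L) (ht : t ∈ interval L) :
    ‖φ s‖ ≤ Real.exp (L * ∫ x in interval L, |v x|) * ‖φ t‖ := by
  obtain ⟨f₁, f₂, hdom, ⟨x₀, hx₀, hne⟩, heq⟩ := hφ
  have hab : -(L / 2) ≤ L / 2 := by linarith
  have hvi := intervalIntegrable_of_memLp_top hv
  have hwmono : MonotoneOn (fun t => ∫ s in (-(L / 2))..t, v s) (Icc (-(L / 2)) (L / 2)) := by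
    intro p hp q _ hpq
    have h1 := intervalIntegral.integral_interval_sub_left (hvi (-(L / 2)) q) (hvi (-(L / 2)) p)
    have h2 := intervalIntegral.integral_nonneg_of_ae (a := p) (b := q) hpq hv0
    simp only
    linarith
  have hw0 : 0 ≤ ∫ s in (-(L / 2))..(L / 2), v s :=
    intervalIntegral.integral_nonneg_of_ae hab hv0
  have hV : ∫ x in interval L, |v x| = ∫ s in (-(L / 2))..(L / 2), v s := by
    rw [intervalIntegral.integral_of_le hab, integral_Ioc_eq_integral_Ioo, interval]
    refine integral_congr_ae (ae_restrict_of_ae ?_)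
    filter_upwards [hv0] with x hx using abs_of_nonneg hx
  obtain ⟨y, z, hz0, hsys⟩ := exists_pos_system_of_isLeast hL hv hw0 hμ
  have hy0 := fun t ht => (hsys t ht).1
  have hy := fun t ht => (hsys t ht).2.1
  have hz := fun t ht => (hsys t ht).2.2
  obtain ⟨c, hc⟩ := exists_eq_const_mul_of_system (w := fun t => ∫ s in (-(L / 2))..t, v s)
    hy0 hy hz hdom.hasDeriv
    (fun t ht => hasDerivWithinAt_quasiDeriv hL hv hdom heq ht) hz0 (by simp [hdom.neumann_left])
  have hc0 : c ≠ 0 := by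
    rintro rfl
    exact hne (by rw [(hc x₀ (Ioo_subset_Icc_self hx₀)).1, zero_mul])
  have hzb : z (L / 2) + (∫ s in (-(L / 2))..(L / 2), v s) * y (L / 2) = 0 := by
    obtain ⟨h1, h2⟩ := hc (L / 2) (right_mem_Icc.2 hab)
    rw [hdom.neumann_right, h1] at h2
    have h3 : c * (z (L / 2) + (∫ s in (-(L / 2))..(L / 2), v s : ℝ) * y (L / 2)) = 0 := by
      linear_combination -h2
    exact_mod_cast (mul_eq_zero.1 h3).resolve_left hc0
  have hμ0 : 0 ≤ μ := by
    refine nonneg_of_integral_eq_zero (by linarith : -(L / 2) < L / 2) (hvi _ _) hv0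
      (fun t ht => (hy t ht).continuousWithinAt) hy0 ?_
    rw [← system_deriv_eq_integral hab hvi hy hz hz0 (right_mem_Icc.2 hab), hzb]
  have key := le_exp_mul_of_system hμ0 hwmono intervalIntegral.integral_same hy0 hy hz hz0 hzb
    (Ioo_subset_Icc_self hs) (Ioo_subset_Icc_self ht)
  have hnorm : ∀ t ∈ interval L, ‖φ t‖ = ‖c‖ * y t := fun t ht => by
    rw [(hc t (Ioo_subset_Icc_self ht)).1, norm_mul, Complex.norm_real, Real.norm_eq_abs,
      abs_of_pos (hy0 t (Ioo_subset_Icc_self ht))]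
  rw [hnorm s hs, hnorm t ht, hV, show L * ∫ s in (-(L / 2))..(L / 2), v s
    = (∫ s in (-(L / 2))..(L / 2), v s) * (L / 2 - -(L / 2)) by ring]
  calc ‖c‖ * y s ≤ ‖c‖ * (Real.exp _ * y t) := mul_le_mul_of_nonneg_left key (norm_nonneg c)
    _ = _ := by ring

/-! ### Normalization and conclusion -/

/-- The supremum of an `L²(I)`-normalized function is at least `1 / √L`. -/
theorem one_div_sqrt_le_iSup {L : ℝ} (hL : 0 < L) {φ : ℝ → ℂ}
    (hbdd : BddAbove (range fun x : interval L => ‖φ x‖))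
    (hφ : ∫ x in interval L, ‖φ x‖ ^ 2 = 1) :
    1 / Real.sqrt L ≤ ⨆ x : interval L, ‖φ x‖ := by
  set S := ⨆ x : interval L, ‖φ x‖ with hS
  have hS0 : 0 ≤ S := Real.iSup_nonneg fun x => norm_nonneg _
  have hvol : volume.real (interval L) = L := by
    rw [interval, Real.volume_real_Ioo_of_le (by linarith)]
    ring
  have hle : ∀ x ∈ interval L, ‖‖φ x‖ ^ 2‖ ≤ S ^ 2 := fun x hx => by
    rw [Real.norm_of_nonneg (sq_nonneg _)]
    exact pow_le_pow_left₀ (norm_nonneg _) (le_ciSup hbdd ⟨x, hx⟩) 2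
  -- This gives `1 = ∫ |φ|² ≤ S² L`.
  have h1 := norm_setIntegral_le_of_norm_le_const (μ := volume) (by simp [interval]) hle
  rw [hφ, hvol, norm_one] at h1
  rw [div_le_iff₀ (Real.sqrt_pos.2 hL)]
  have h2 : 1 ≤ (S * Real.sqrt L) ^ 2 := by rwa [mul_pow, Real.sq_sqrt hL.le]
  exact (one_le_sq_iff₀ (by positivity)).1 h2

end NeumannSchrodinger

theorem lemma2p2 (v : ℝ → ℝ) (hv : MemLp v ⊤ volume) (hv_nonneg : 0 ≤ᵐ[volume] v)
    (L : ℝ) (hL : 0 < L) (φ : ℝ → ℂ)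
    (hφ : NeumannSchrodinger.IsNormalizedGroundState v L φ) :
    Real.exp (-4 * L * ∫ x in NeumannSchrodinger.interval L, |v x|) / Real.sqrt L
        ≤ (⨅ x : NeumannSchrodinger.interval L, ‖φ x‖) ∧
      Real.exp (-4 * L * ∫ x in NeumannSchrodinger.interval L, |v x|)
          * (⨆ x : NeumannSchrodinger.interval L, ‖φ x‖)
        ≤ ⨅ x : NeumannSchrodinger.interval L, ‖φ x‖ := by
  obtain ⟨μ, hμ, hφμ, hnorm⟩ := hφ
  set V := ∫ x in NeumannSchrodinger.interval L, |v x| with hV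
  have hV0 : 0 ≤ V := integral_nonneg fun x => abs_nonneg (v x)
  -- The Harnack constant proved is `exp (L V)`; the factor `4` only weakens it.
  have hexp : Real.exp (L * V) ≤ Real.exp (4 * L * V) :=
    Real.exp_le_exp.2 (by nlinarith [mul_nonneg hL.le hV0])
  have hharnack : ∀ s t : NeumannSchrodinger.interval L,
      ‖φ s‖ ≤ Real.exp (4 * L * V) * ‖φ t‖ := fun s t =>
    (NeumannSchrodinger.norm_le_exp_mul_norm_of_isLeast hL hv hv_nonneg hμ hφμ s.2 t.2).trans
      (mul_le_mul_of_nonneg_right hexp (norm_nonneg _))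
  have : Nonempty (NeumannSchrodinger.interval L) :=
    ⟨⟨0, by constructor <;> linarith⟩⟩
  -- For an unbounded family the real supremum would take the default value `0`.
  have hbdd : BddAbove (Set.range fun x : NeumannSchrodinger.interval L => ‖φ x‖) :=
    ⟨_, Set.forall_mem_range.2 fun s => hharnack s (Classical.arbitrary _)⟩
  have hsup : Real.exp (-4 * L * V) * (⨆ x : NeumannSchrodinger.interval L, ‖φ x‖)
      ≤ ⨅ x : NeumannSchrodinger.interval L, ‖φ x‖ := by
    refine le_ciInf fun t => ?_
    rw [show -4 * L * V = -(4 * L * V) by ring, Real.exp_neg, inv_mul_le_iff₀ (Real.exp_pos _)]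
    exact ciSup_le fun s => hharnack s t
  refine ⟨le_trans ?_ hsup, hsup⟩
  rw [div_eq_mul_one_div]
  exact mul_le_mul_of_nonneg_left (NeumannSchrodinger.one_div_sqrt_le_iSup hL hbdd hnorm)
    (Real.exp_pos _).le
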